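/- All graphs are finite and simple; the eigenvalues and eigenvectors of a graph are those of its adjacency matrix, an eigenvector is non-zero, and the multiplicity of an eigenvalue is the dimension of its eigenspace. $\mathfrak C(G)$ is the set of connected components of $G$, and for a set $M$ of vertex-disjoint connected subgraphs, $G/M$ is obtained from $G$ by contracting each member of $M$ to a single vertex. **Definitions.** For a tree $T$ and $\lambda\in\mathbb R$, let $N_\lambda(T)$ be the set of vertices on which every eigenvector of $T$ for $\lambda$ vanishes, and let $N^C_\lambda(T)$ be the set of vertices $v$ for which some eigenvector of $T$ for $\lambda$ vanishes at $v$ but not at some neighbour of $v$. The *skeleton* $S_\lambda(T)$ is the subgraph of $T/\mathfrak C(T\setminus N_\lambda(T))$ induced by $N^C_\lambda(T)$ together with the vertices contracted from the components of $T\setminus N_\lambda(T)$. The *meta skeleton* of $T$ for $\lambda$ is $T/\mathfrak C(T\setminus N^C_\lambda(T))$. A tree $S'$ is called a *meta skeleton with non-eigenvalue set* $X\subseteq V(S')$ if $X$ is independent; no component of $S'\setminus X$ has a perfect matching; every vertex of a component $C$ of $S'\setminus X$ that is adjacent in $S'$ to a vertex of $X$ is covered by every maximum matching of $C$; and no edge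 of $S'\setminus X$ is contained in every maximum matching of $S'\setminus X$. **Construction.** Let $S'$ be a meta skeleton with non-eigenvalue set $X\neq V(S')$ and let $\lambda\in\mathbb R$. Replace every vertex of $X$ by a tree without eigenvalue $\lambda$. Replace every vertex of $S'\setminus X$ that is missed by some maximum matching of its component of $S'\setminus X$ by a tree that has an eigenvector for $\lambda$ without zero entries. All other vertices are kept. For each edge $uv$ of $S'$, join one arbitrarily chosen vertex of the tree replacing $u$ (or $u$ itself, if it is kept) to one arbitrarily chosen vertex of the tree replacing $v$ (or $v$ itself). Let $T$ be a graph obtained in this way (whenever trees as required exist). **Theorem.** $T$ is a tree and $\lambda$ is an eigenvalue of $T$. Its multiplicity equals the number of vertices of $S'\setminus X$ missed by any maximum matching of $S'\setminus X$. Moreover, $S_\lambda(T)=S'\setminus X$ and $T/\mathfrak C(T\setminus N^C_\lambda(T))=S'$, where both equalities are graph isomorphisms that send each vertex of the left-hand graph, contracted from (or equal to) vertices of the tree that replaced a vertex $v$ of $S'$ (or equal to $v$, if $v$ was kept), to $v$. -/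

import Mathlib

universe u w

namespace TreeSkeleton

noncomputable section

/-! ### Eigenvalues and vanishing sets -/

open Classical in
/-- The adjacency matrix of `G`, as an endomorphism of `V → ℝ`. -/
def adjEnd {V : Type u} [Fintype V] (G : SimpleGraph V) : Module.End ℝ (V → ℝ) :=
  (G.adjMatrix ℝ).mulVecLin

/-- `lam` is an eigenvalue of the graph `G`. -/
def HasEigenvalue {V : Type u} [Fintype V] (G : SimpleGraph V) (lam : ℝ) : Prop :=
  Module.End.HasEigenvalue (adjEnd G) lam

/-- `x` is an eigenvector (in particular `x ≠ 0`) of `G` for the eigenvalue `lam`. -/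
def IsEigenvector {V : Type u} [Fintype V] (G : SimpleGraph V) (lam : ℝ) (x : V → ℝ) : Prop :=
  Module.End.HasEigenvector (adjEnd G) lam x

/-- The multiplicity of `lam` as an eigenvalue of `G`: the dimension of the eigenspace. -/
def multiplicity {V : Type u} [Fintype V] (G : SimpleGraph V) (lam : ℝ) : ℕ :=
  Module.finrank ℝ (Module.End.eigenspace (adjEnd G) lam)

/-- `N(G, x)`: the vertices on which `x` vanishes. -/
def zeroSet {V : Type u} (x : V → ℝ) : Set V := {v | x v = 0}

/-- `N_lam(G)`: the vertices on which every eigenvector for `lam` vanishes. -/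
def commonZeroSet {V : Type u} [Fintype V] (G : SimpleGraph V) (lam : ℝ) : Set V :=
  {v | ∀ x, IsEigenvector G lam x → v ∈ zeroSet x}

/-- `N^C(G, x)`: the vertices of `N(G, x)` adjacent to some component of `G \ N(G, x)`, that is,
to some vertex outside `N(G, x)`. -/
def boundaryZeroSet {V : Type u} (G : SimpleGraph V) (x : V → ℝ) : Set V :=
  {v | v ∈ zeroSet x ∧ ∃ w, w ∉ zeroSet x ∧ G.Adj v w}

/-- `N^C_lam(G)`: the union of the sets `N^C(G, x)` over all eigenvectors `x` for `lam`. -/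
def commonBoundaryZeroSet {V : Type u} [Fintype V] (G : SimpleGraph V) (lam : ℝ) : Set V :=
  {v | ∃ x, IsEigenvector G lam x ∧ v ∈ boundaryZeroSet G x}

/-! ### Contraction of the components of `G \ Z`, skeleton and meta skeleton of a tree -/

/-- Two vertices are identified if they are equal or lie in a common component of `G \ Z`. -/
def contractSetoid {V : Type u} (G : SimpleGraph V) (Z : Set V) : Setoid V where
  r a b := a = b ∨ ∃ (ha : a ∈ Zᶜ) (hb : b ∈ Zᶜ), (G.induce Zᶜ).Reachable ⟨a, ha⟩ ⟨b, hb⟩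
  iseqv :=
    { refl := fun _ => Or.inl rfl
      symm := by
        rintro a b (rfl | ⟨ha, hb, h⟩)
        · exact Or.inl rfl
        · exact Or.inr ⟨hb, ha, h.symm⟩
      trans := by
        rintro a b c (rfl | ⟨ha, hb, h⟩) (rfl | ⟨hb', hc, h'⟩)
        · exact Or.inl rfl
        · exact Or.inr ⟨hb', hc, h'⟩
        · exact Or.inr ⟨ha, hb, h⟩
        · exact Or.inr ⟨ha, hc, h.trans h'⟩ }

/-- The vertices of `G / 𝒞(G \ Z)`. -/
abbrev ContractVert {V : Type u} (G : SimpleGraph V) (Z : Set V) : Type u :=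
  Quotient (contractSetoid G Z)

/-- The vertex of `G / 𝒞(G \ Z)` to which a vertex of `G` is contracted. -/
def contractMk {V : Type u} (G : SimpleGraph V) (Z : Set V) (v : V) : ContractVert G Z :=
  Quotient.mk (contractSetoid G Z) v

/-- The graph `G / 𝒞(G \ Z)`, in which each component of `G \ Z` is contracted to one vertex:
distinct vertices are adjacent if some edge of `G` joins vertices contracted to them. -/
def contract {V : Type u} (G : SimpleGraph V) (Z : Set V) : SimpleGraph (ContractVert G Z) :=
  G.map (contractMk G Z)

/-- The vertex set of the skeleton in `G / 𝒞(G \ N_lam(G))`: the vertices of `N^C_lam(G)` and the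
vertices contracted from the components of `G \ N_lam(G)`. -/
def skeletonVerts {V : Type u} [Fintype V] (G : SimpleGraph V) (lam : ℝ) :
    Set (ContractVert G (commonZeroSet G lam)) :=
  contractMk G (commonZeroSet G lam) '' (commonBoundaryZeroSet G lam ∪ (commonZeroSet G lam)ᶜ)

/-- The skeleton `S_lam(G)`. -/
def skeleton {V : Type u} [Fintype V] (G : SimpleGraph V) (lam : ℝ) :
    SimpleGraph (skeletonVerts G lam) :=
  (contract G (commonZeroSet G lam)).induce (skeletonVerts G lam)

/-- The meta skeleton `G / 𝒞(G \ N^C_lam(G))`. -/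
def metaSkeleton {V : Type u} [Fintype V] (G : SimpleGraph V) (lam : ℝ) :
    SimpleGraph (ContractVert G (commonBoundaryZeroSet G lam)) :=
  contract G (commonBoundaryZeroSet G lam)

/-! ### Maximum matchings and abstract meta skeletons -/

/-- `M` is a matching of `G` with the greatest possible number of edges. -/
def IsMaximumMatching {V : Type u} {G : SimpleGraph V} (M : G.Subgraph) : Prop :=
  M.IsMatching ∧ ∀ M' : G.Subgraph, M'.IsMatching → M'.edgeSet.ncard ≤ M.edgeSet.ncard

/-- `v` may be missed by a maximum matching of `G`. -/
def MayBeMissed {V : Type u} (G : SimpleGraph V) (v : V) : Prop :=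
  ∃ M : G.Subgraph, IsMaximumMatching M ∧ v ∉ M.verts

/-- `v` may be missed by a maximum matching of the component of `G` that contains it. -/
def MayBeMissedInComponent {V : Type u} (G : SimpleGraph V) (v : V) : Prop :=
  MayBeMissed (G.connectedComponentMk v).toSimpleGraph
    ⟨v, SimpleGraph.ConnectedComponent.connectedComponentMk_mem⟩

/-- `S` is a meta skeleton with admissible non-eigenvalue set `X`. -/
structure IsMetaSkeleton {V : Type u} (S : SimpleGraph V) (X : Set V) : Prop where
  isTree : S.IsTree
  isIndepSet : S.IsIndepSet X
  no_perfect_matching : ∀ C : (S.induce Xᶜ).ConnectedComponent,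
    ∀ M : C.toSimpleGraph.Subgraph, ¬ M.IsPerfectMatching
  /-- Only vertices contained in every maximum matching of their component are adjacent to `X`. -/
  adj_not_missed : ∀ (c : ↥Xᶜ) (x : V), x ∈ X → S.Adj c x →
    ¬ MayBeMissedInComponent (S.induce Xᶜ) c
  no_edge_in_all : ∀ e ∈ (S.induce Xᶜ).edgeSet,
    ∃ M : (S.induce Xᶜ).Subgraph, IsMaximumMatching M ∧ e ∉ M.edgeSet

/-- `v` lies outside `X` and may be missed by a maximum matching of its component of `S \ X`. -/
def IsMissable {V : Type u} (S : SimpleGraph V) (X : Set V) (v : V) : Prop :=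
  ∃ hv : v ∈ Xᶜ, MayBeMissedInComponent (S.induce Xᶜ) ⟨v, hv⟩

/-! ### Blowing up -/

/-- The choices made when blowing up `S` with non-eigenvalue set `X` for the number `lam`. Every
vertex `v` receives a tree `part v`: one without eigenvalue `lam` if `v ∈ X`, one with a nowhere
vanishing eigenvector for `lam` if `v` is missable, and a single vertex (`v` is not substituted)
otherwise. For an edge `uv` of `S`, `attach u v` is the vertex of `part u` chosen as its end (the
values of `attach` on non-adjacent pairs are not used). -/
structure BlowUp {V : Type u} (S : SimpleGraph V) (X : Set V) (lam : ℝ) where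
  Part : V → Type w
  [fintypePart : ∀ v, Fintype (Part v)]
  part : ∀ v, SimpleGraph (Part v)
  part_isTree : ∀ v, (part v).IsTree
  part_of_mem : ∀ v ∈ X, ¬ HasEigenvalue (part v) lam
  part_of_missable : ∀ v, IsMissable S X v →
    ∃ y : Part v → ℝ, IsEigenvector (part v) lam y ∧ ∀ a, y a ≠ 0
  part_of_other : ∀ v, v ∉ X → ¬ IsMissable S X v → Subsingleton (Part v)
  attach : ∀ u : V, V → Part u

namespace BlowUp

variable {V : Type u} {S : SimpleGraph V} {X : Set V} {lam : ℝ}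

instance instFintypePart (B : BlowUp.{u, w} S X lam) (v : V) : Fintype (B.Part v) :=
  B.fintypePart v

/-- The vertices of the blown-up graph. -/
abbrev Vert (B : BlowUp.{u, w} S X lam) : Type (max u w) := Σ v, B.Part v

/-- Adjacency in the blown-up graph: the edges of the substituted trees, and for each edge of `S`
one edge between the chosen end vertices. -/
inductive Adj (B : BlowUp.{u, w} S X lam) : B.Vert → B.Vert → Prop
  | inner {v : V} {a b : B.Part v} (h : (B.part v).Adj a b) : Adj B ⟨v, a⟩ ⟨v, b⟩
  | link {u v : V} (h : S.Adj u v) : Adj B ⟨u, B.attach u v⟩ ⟨v, B.attach v u⟩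

/-- The blown-up graph. -/
def graph (B : BlowUp.{u, w} S X lam) : SimpleGraph B.Vert where
  Adj := B.Adj
  symm := ⟨by
    rintro _ _ (h | h)
    · exact Adj.inner h.symm
    · exact Adj.link h.symm⟩
  loopless := ⟨by
    rintro ⟨v, a⟩ h
    have key : ∀ p q : B.Vert, B.Adj p q → p ≠ q := by
      rintro _ _ (h | h) hpq
      · exact h.ne (eq_of_heq (Sigma.mk.inj_iff.1 hpq).2)
      · exact h.ne (congrArg Sigma.fst hpq)
    exact key _ _ h rfl⟩

end BlowUp

end

end TreeSkeleton

/-!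
Two matchings of a forest neither of which uses the edge `uv` can be spliced along the cut at `uv`.
Splicing maximum matchings shows that missable vertices are pairwise non-adjacent, and that, as no
edge of `S \ X` lies in every maximum matching, each maximum matching pairs every core vertex
(neither missable nor in `X`) with a missable one.

Let `x` be an eigenvector of the blown-up tree. Pairing `x` on the tree substituted for a missable
vertex with the nowhere vanishing eigenvector of that tree gives one linear equation in the values
of `x` on the core. The matrix of this system, the link matrix, is supported on edges of a forest,
and a forest has at most one perfect matching, so a maximum matching of `S \ X` selects a square
submatrix whose determinant is a single non-zero product. Hence `x` vanishes on the core, therefore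
on the trees without eigenvalue `lam`, and on every other tree it is a multiple of the given
eigenvector. The possible coefficients form the left kernel of the link matrix, whose dimension is
the number of missable vertices minus the number of core vertices. Using a maximum matching that
misses `d` leaves the row of `d` out of the invertible submatrix, so some eigenvector does not
vanish over `d`. This determines all vanishing sets, and with them the contractions.
-/

namespace TreeSkeleton

/-! ### Cuts of forests -/

section FarSide

variable {V : Type u} {G : SimpleGraph V} {u v a b : V}

/-- The vertices that can be reached from `v` without using the edge `uv`: in a forest, the side of
`v` in the cut of `G` along `uv`. -/
def farSide (G : SimpleGraph V) (u v : V) : Set V :=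
  {w | (G.deleteEdges {s(u, v)}).Reachable v w}

lemma mem_farSide_self (G : SimpleGraph V) (u v : V) : v ∈ farSide G u v :=
  SimpleGraph.Reachable.refl _

lemma mem_farSide_of_adj (hab : G.Adj a b) (hne : s(a, b) ≠ s(u, v)) (ha : a ∈ farSide G u v) :
    b ∈ farSide G u v :=
  SimpleGraph.Reachable.trans ha <| SimpleGraph.Adj.reachable <|
    SimpleGraph.deleteEdges_adj.2 ⟨hab, by simpa using hne⟩

lemma notMem_farSide (hG : G.IsAcyclic) (h : G.Adj u v) : u ∉ farSide G u v := fun hu =>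
  SimpleGraph.isBridge_iff.1 (SimpleGraph.isAcyclic_iff_forall_adj_isBridge.1 hG h) hu.symm

lemma eq_of_adj_of_mem_farSide (hG : G.IsAcyclic) (h : G.Adj u v) (hab : G.Adj a b)
    (ha : a ∈ farSide G u v) (hb : b ∉ farSide G u v) : a = v ∧ b = u := by
  by_cases he : s(a, b) = s(u, v)
  · rcases Sym2.eq_iff.1 he with ⟨rfl, rfl⟩ | hvu
    · exact absurd ha (notMem_farSide hG h)
    · exact hvu
  · exact absurd (mem_farSide_of_adj hab he ha) hb

end FarSide

/-! ### Matchings as involutions -/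

section MatchingMap

open Function Set

variable {V : Type u} {G : SimpleGraph V} {m n : V → V} {U : Set V} {a b v : V}

/-- `m` is an involution that moves vertices only along edges of `G`. Such maps encode the matchings
of `G`: the edges of the matching join each `v` with `m v ≠ v`, and the fixed points of `m` are
the vertices missed by the matching. -/
structure IsMatchingMap (G : SimpleGraph V) (m : V → V) : Prop where
  invol : Involutive m
  adj : ∀ v, m v ≠ v → G.Adj v (m v)

/-- `m` encodes a maximum matching, that is, one missing as few vertices as possible. -/
structure IsMaxMatchingMap (G : SimpleGraph V) (m : V → V) : Prop extends IsMatchingMap G m where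
  ncard_le : ∀ n, IsMatchingMap G n → (fixedPoints m).ncard ≤ (fixedPoints n).ncard

lemma isMatchingMap_id : IsMatchingMap G id := ⟨fun _ => rfl, fun _ h => (h rfl).elim⟩

lemma exists_isMaxMatchingMap (G : SimpleGraph V) : ∃ m, IsMaxMatchingMap G m := by
  obtain ⟨m, hm⟩ := exists_minimalFor_of_wellFoundedLT (IsMatchingMap G)
    (fun m => (fixedPoints m).ncard) ⟨id, isMatchingMap_id⟩
  exact ⟨m, hm.prop, fun n hn => (le_total _ _).elim id (hm.le_of_le hn)⟩

lemma IsMaxMatchingMap.of_ncard_le (hm : IsMaxMatchingMap G m) (hn : IsMatchingMap G n)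
    (h : (fixedPoints n).ncard ≤ (fixedPoints m).ncard) : IsMaxMatchingMap G n :=
  ⟨hn, fun k hk => h.trans (hm.ncard_le k hk)⟩

lemma IsMatchingMap.mapsTo_compl (hm : IsMatchingMap G m) (h : MapsTo m U U) : MapsTo m Uᶜ Uᶜ :=
  fun v hv hmv => hv (hm.invol v ▸ h hmv)

lemma IsMatchingMap.mapsTo_of_adj (hm : IsMatchingMap G m)
    (hU : ∀ a ∈ U, ∀ b, G.Adj a b → b ∈ U) : MapsTo m U U := fun v hv => by
  by_cases h : m v = v
  · rwa [h]
  · exact hU v hv _ (hm.adj v h)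

lemma IsMatchingMap.piecewise [∀ v, Decidable (v ∈ U)] (hm : IsMatchingMap G m)
    (hn : IsMatchingMap G n) (hmU : MapsTo m U U) (hnU : MapsTo n U U) :
    IsMatchingMap G (U.piecewise m n) := by
  constructor <;> intro v <;> by_cases hv : v ∈ U
  · rw [piecewise_eq_of_mem _ _ _ hv, piecewise_eq_of_mem _ _ _ (hmU hv), hm.invol]
  · rw [piecewise_eq_of_notMem _ _ _ hv, piecewise_eq_of_notMem _ _ _ (hn.mapsTo_compl hnU hv),
      hn.invol]
  · simpa only [hv, piecewise_eq_of_mem] using hm.adj v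
  · simpa only [hv, not_false_eq_true, piecewise_eq_of_notMem] using hn.adj v

lemma fixedPoints_piecewise [∀ v, Decidable (v ∈ U)] (m n : V → V) :
    fixedPoints (U.piecewise m n) = fixedPoints m ∩ U ∪ fixedPoints n \ U := by
  ext v
  by_cases hv : v ∈ U <;> simp [hv, mem_fixedPoints, IsFixedPt]

lemma ncard_fixedPoints_piecewise_add [Finite V] [∀ v, Decidable (v ∈ U)] (m n : V → V) :
    (fixedPoints (U.piecewise m n)).ncard + (fixedPoints (U.piecewise n m)).ncard =
      (fixedPoints m).ncard + (fixedPoints n).ncard := by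
  have hdisj (s t : Set V) : Disjoint (s ∩ U) (t \ U) :=
    disjoint_sdiff_right.mono_left inter_subset_right
  have := ncard_inter_add_ncard_sdiff_eq_ncard (fixedPoints m) U
  have := ncard_inter_add_ncard_sdiff_eq_ncard (fixedPoints n) U
  rw [fixedPoints_piecewise, fixedPoints_piecewise, ncard_union_eq (hdisj _ _),
    ncard_union_eq (hdisj _ _)]
  omega

lemma IsMaxMatchingMap.piecewise [Finite V] [∀ v, Decidable (v ∈ U)] (hm : IsMaxMatchingMap G m)
    (hn : IsMaxMatchingMap G n) (hmU : MapsTo m U U) (hnU : MapsTo n U U) :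
    IsMaxMatchingMap G (U.piecewise m n) := by
  refine hn.of_ncard_le (hm.toIsMatchingMap.piecewise hn.toIsMatchingMap hmU hnU) ?_
  have := hm.ncard_le _ (hn.toIsMatchingMap.piecewise hm.toIsMatchingMap hnU hmU)
  have := ncard_fixedPoints_piecewise_add (U := U) m n
  omega

lemma isMatchingMap_swap [DecidableEq V] (hab : G.Adj a b) :
    IsMatchingMap G (Equiv.swap a b) := by
  refine ⟨Equiv.swap_apply_self a b, fun v hv => ?_⟩
  rcases (Equiv.swap_apply_ne_self_iff.1 hv).2 with rfl | rfl
  · rwa [Equiv.swap_apply_left]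
  · rw [Equiv.swap_apply_right]
    exact hab.symm

lemma IsMaxMatchingMap.not_adj_of_apply_eq [Finite V] (hm : IsMaxMatchingMap G m) (ha : m a = a)
    (hb : m b = b) : ¬ G.Adj a b := fun hab => by
  classical
  have hswap : MapsTo (Equiv.swap a b) {a, b} {a, b} := by
    rintro v (rfl | rfl) <;> simp
  have hfix : MapsTo m {a, b} {a, b} := by
    rintro v (rfl | rfl) <;> simp [ha, hb]
  have hsub : fixedPoints (({a, b} : Set V).piecewise (Equiv.swap a b) m) ⊂ fixedPoints m := by
    refine (ssubset_iff_of_subset fun v hv => ?_).2 ⟨a, ha, fun h => hab.ne' ?_⟩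
    · by_cases hvU : v ∈ ({a, b} : Set V)
      · rcases hvU with rfl | rfl <;> assumption
      · rwa [mem_fixedPoints, IsFixedPt, piecewise_eq_of_notMem _ _ _ hvU] at hv
    · rwa [mem_fixedPoints, IsFixedPt, piecewise_eq_of_mem _ _ _ (mem_insert a _),
        Equiv.swap_apply_left] at h
  exact (ncard_lt_ncard hsub).not_ge <|
    hm.ncard_le _ ((isMatchingMap_swap hab).piecewise hm.toIsMatchingMap hswap hfix)

lemma IsMatchingMap.erase [DecidableEq V] (hm : IsMatchingMap G m) (a : V) :
    IsMatchingMap G (({a, m a} : Set V).piecewise id m) := by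
  refine isMatchingMap_id.piecewise hm (mapsTo_id _) ?_
  rintro v (rfl | rfl)
  · exact Or.inr rfl
  · exact Or.inl (hm.invol a)

lemma IsMatchingMap.ncard_fixedPoints_erase [Finite V] [DecidableEq V] (hm : IsMatchingMap G m)
    (ha : m a ≠ a) :
    (fixedPoints (({a, m a} : Set V).piecewise id m)).ncard = (fixedPoints m).ncard + 2 := by
  have hfix : fixedPoints m \ {a, m a} = fixedPoints m := by
    refine sdiff_eq_left.2 (disjoint_right.2 ?_)
    rintro v (rfl | rfl) hv
    · exact ha hv
    · exact ha (hm.invol.injective hv)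
  rw [fixedPoints_piecewise, hfix, fixedPoints_id, univ_inter,
    ncard_union_eq (hfix ▸ disjoint_sdiff_right), ncard_pair ha.symm, add_comm]

/-- The matching encoded by `m`, as a subgraph covering exactly the vertices moved by `m`. -/
def IsMatchingMap.toSubgraph (hm : IsMatchingMap G m) : G.Subgraph where
  verts := (fixedPoints m)ᶜ
  Adj v w := m v = w ∧ v ≠ w
  adj_sub := by
    rintro v w ⟨rfl, h⟩
    exact hm.adj v h.symm
  edge_vert := by
    rintro v w ⟨rfl, h⟩
    exact h.symm
  symm := ⟨by
    rintro v w ⟨rfl, h⟩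
    exact ⟨hm.invol v, h.symm⟩⟩

lemma IsMatchingMap.isMatching_toSubgraph (hm : IsMatchingMap G m) : hm.toSubgraph.IsMatching :=
  fun v hv => ⟨m v, ⟨rfl, Ne.symm hv⟩, fun _ h => h.1.symm⟩

lemma exists_toSubgraph_eq {M : G.Subgraph} (hM : M.IsMatching) :
    ∃ m, ∃ hm : IsMatchingMap G m, hm.toSubgraph = M := by
  classical
  choose f hf hf' using fun v (hv : v ∈ M.verts) => hM hv
  let m : V → V := fun v => if hv : v ∈ M.verts then f v hv else v
  have eq_of_adj : ∀ {v w}, M.Adj v w → m v = w := fun {v w} h =>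
    (dif_pos (M.edge_vert h)).trans (hf' v _ w h).symm
  have adj_of_mem : ∀ {v}, v ∈ M.verts → M.Adj v (m v) := fun {v} hv => by
    simpa only [m, dif_pos hv] using hf v hv
  have mem_of_ne : ∀ {v}, m v ≠ v → v ∈ M.verts := fun h => by
    by_contra hv
    exact h (dif_neg hv)
  have hm : IsMatchingMap G m := by
    refine ⟨fun v => ?_, fun v hv => (adj_of_mem (mem_of_ne hv)).adj_sub⟩
    by_cases hv : m v = v
    · rw [hv, hv]
    · exact eq_of_adj (adj_of_mem (mem_of_ne hv)).symm
  refine ⟨m, hm, SimpleGraph.Subgraph.ext ?_ ?_⟩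
  · ext v
    exact ⟨mem_of_ne, fun hv => (adj_of_mem hv).ne.symm⟩
  · ext v w
    refine ⟨?_, fun h => ⟨eq_of_adj h, h.ne⟩⟩
    rintro ⟨rfl, h⟩
    exact adj_of_mem (mem_of_ne h.symm)

lemma two_mul_ncard_edgeSet [Finite V] {M : G.Subgraph} (hM : M.IsMatching) :
    2 * M.edgeSet.ncard = M.verts.ncard := by
  classical
  have := Fintype.ofFinite V
  have hedges : M.edgeSet.ncard = M.coe.edgeFinset.card := by
    rw [← SimpleGraph.Subgraph.image_coe_edgeSet_coe,
      ncard_image_of_injective _ (Sym2.map.injective Subtype.coe_injective),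
      ← SimpleGraph.coe_edgeFinset, ncard_coe_finset]
  calc 2 * M.edgeSet.ncard = ∑ v : M.verts, M.coe.degree v := by
        rw [hedges]
        convert M.coe.sum_degrees_eq_twice_card_edges.symm
    _ = ∑ _v : M.verts, 1 := Finset.sum_congr rfl fun v _ => by
        rw [SimpleGraph.Subgraph.coe_degree]
        convert SimpleGraph.Subgraph.isMatching_iff_forall_degree.1 hM v v.2
    _ = M.verts.ncard := by
        simp only [Finset.sum_const, Finset.card_univ, smul_eq_mul, mul_one,
          ncard_eq_toFinset_card', toFinset_card]

lemma IsMatchingMap.two_mul_ncard_edgeSet_add [Finite V] (hm : IsMatchingMap G m) :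
    2 * hm.toSubgraph.edgeSet.ncard + (fixedPoints m).ncard = Nat.card V := by
  rw [two_mul_ncard_edgeSet hm.isMatching_toSubgraph, add_comm]
  exact ncard_add_ncard_compl _

lemma isMaximumMatching_toSubgraph_iff [Finite V] (hm : IsMatchingMap G m) :
    IsMaximumMatching hm.toSubgraph ↔ IsMaxMatchingMap G m := by
  have hcard := hm.two_mul_ncard_edgeSet_add
  refine ⟨fun h => ⟨hm, fun n hn => ?_⟩, fun h => ⟨hm.isMatching_toSubgraph, fun N hN => ?_⟩⟩
  · have := h.2 _ hn.isMatching_toSubgraph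
    have := hn.two_mul_ncard_edgeSet_add
    omega
  · obtain ⟨n, hn, rfl⟩ := exists_toSubgraph_eq hN
    have := h.ncard_le n hn
    have := hn.two_mul_ncard_edgeSet_add
    omega

lemma IsMaximumMatching.exists_toSubgraph_eq [Finite V] {M : G.Subgraph}
    (hM : IsMaximumMatching M) :
    ∃ m, ∃ hm : IsMaxMatchingMap G m, hm.toIsMatchingMap.toSubgraph = M := by
  obtain ⟨m, hm, rfl⟩ := TreeSkeleton.exists_toSubgraph_eq hM.1
  exact ⟨m, (isMaximumMatching_toSubgraph_iff hm).1 hM, rfl⟩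

lemma mayBeMissed_iff [Finite V] : MayBeMissed G v ↔ ∃ m, IsMaxMatchingMap G m ∧ m v = v := by
  constructor
  · rintro ⟨M, hM, hv⟩
    obtain ⟨m, hm, rfl⟩ := hM.exists_toSubgraph_eq
    exact ⟨m, hm, not_not.1 hv⟩
  · rintro ⟨m, hm, hv⟩
    exact ⟨_, (isMaximumMatching_toSubgraph_iff hm.toIsMatchingMap).2 hm, not_not.2 hv⟩

/-- The extension of a self-map of `U` by the identity. -/
noncomputable def extendById (n : U → U) : V → V :=
  extend Subtype.val (Subtype.val ∘ n) id

lemma extendById_coe (n : U → U) (v : U) : extendById n v = n v :=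
  Subtype.val_injective.extend_apply _ _ v

lemma extendById_of_notMem (n : U → U) (hv : v ∉ U) : extendById n v = v :=
  extend_apply' _ _ _ fun ⟨w, hw⟩ => hv (hw ▸ w.2)

lemma mapsTo_extendById (n : U → U) : MapsTo (extendById n) U U := fun v hv =>
  extendById_coe n ⟨v, hv⟩ ▸ (n ⟨v, hv⟩).2

lemma extendById_restrict [∀ v, Decidable (v ∈ U)] (h : MapsTo m U U) :
    extendById (h.restrict m U U) = U.piecewise m id := by
  ext v
  by_cases hv : v ∈ U
  · rw [piecewise_eq_of_mem _ _ _ hv]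
    exact extendById_coe (h.restrict m U U) ⟨v, hv⟩
  · rw [piecewise_eq_of_notMem _ _ _ hv]
    exact extendById_of_notMem _ hv

lemma ncard_fixedPoints_extendById [Finite V] (n : U → U) :
    (fixedPoints (extendById n)).ncard = (fixedPoints n).ncard + Uᶜ.ncard := by
  have hfix : fixedPoints (extendById n) = Subtype.val '' fixedPoints n ∪ Uᶜ := by
    ext v
    by_cases hv : v ∈ U
    · simp [hv, mem_fixedPoints, IsFixedPt, extendById_coe n ⟨v, hv⟩, Subtype.ext_iff]
    · simp [hv, mem_fixedPoints, IsFixedPt, extendById_of_notMem n hv]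
  rw [hfix, ncard_union_eq, ncard_image_of_injective _ Subtype.val_injective]
  exact disjoint_compl_right.mono_left (Subtype.coe_image_subset U _)

lemma IsMatchingMap.extendById {n : U → U} (hn : IsMatchingMap (G.induce U) n) :
    IsMatchingMap G (extendById n) := by
  constructor <;> intro v <;> by_cases hv : v ∈ U
  · lift v to U using hv
    rw [extendById_coe, extendById_coe, hn.invol]
  · rw [extendById_of_notMem n hv, extendById_of_notMem n hv]
  · lift v to U using hv
    rw [extendById_coe]
    exact fun h => hn.adj v fun h' => h (congrArg Subtype.val h')
  · exact fun h => (h (extendById_of_notMem n hv)).elim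

lemma IsMatchingMap.restrict (hm : IsMatchingMap G m) (h : MapsTo m U U) :
    IsMatchingMap (G.induce U) (h.restrict m U U) :=
  ⟨fun v => Subtype.ext (hm.invol v), fun v hv => hm.adj v fun h' => hv (Subtype.ext h')⟩

lemma ncard_fixedPoints_piecewise_extendById [Finite V] [∀ v, Decidable (v ∈ U)] (n : U → U)
    (h : MapsTo m U U) :
    (fixedPoints (U.piecewise (extendById n) m)).ncard + (fixedPoints (h.restrict m U U)).ncard =
      (fixedPoints m).ncard + (fixedPoints n).ncard := by
  have hswap : U.piecewise m (extendById n) = extendById (h.restrict m U U) := by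
    rw [extendById_restrict]
    ext v
    by_cases hv : v ∈ U <;> simp [hv, extendById_of_notMem]
  have hsum := ncard_fixedPoints_piecewise_add (U := U) (extendById n) m
  have := ncard_fixedPoints_extendById n
  have := ncard_fixedPoints_extendById (h.restrict m U U)
  rw [hswap] at hsum
  omega

lemma mayBeMissed_induce_iff [Finite V] (hU : ∀ a ∈ U, ∀ b, G.Adj a b → b ∈ U) (v : U) :
    MayBeMissed (G.induce U) v ↔ MayBeMissed G (v : V) := by
  classical
  rw [mayBeMissed_iff, mayBeMissed_iff]
  constructor
  · rintro ⟨n, hn, hv⟩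
    obtain ⟨m, hm⟩ := exists_isMaxMatchingMap G
    have hmU := hm.mapsTo_of_adj hU
    refine ⟨U.piecewise (extendById n) m, hm.of_ncard_le
      (hn.extendById.piecewise hm.toIsMatchingMap (mapsTo_extendById n) hmU) ?_, ?_⟩
    · have := hn.ncard_le _ (hm.restrict hmU)
      have := ncard_fixedPoints_piecewise_extendById n hmU
      omega
    · rw [piecewise_eq_of_mem _ _ _ v.2, extendById_coe, hv]
  · rintro ⟨m, hm, hv⟩
    have hmU := hm.mapsTo_of_adj hU
    refine ⟨_, ⟨hm.restrict hmU, fun n hn => ?_⟩, Subtype.ext hv⟩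
    have := hm.ncard_le _
      (hn.extendById.piecewise hm.toIsMatchingMap (mapsTo_extendById n) hmU)
    have := ncard_fixedPoints_piecewise_extendById n hmU
    omega

lemma mayBeMissedInComponent_iff [Finite V] (v : V) :
    MayBeMissedInComponent G v ↔ MayBeMissed G v := by
  refine mayBeMissed_induce_iff (U := (G.connectedComponentMk v).supp) (fun a ha b hab => ?_)
    ⟨v, _⟩
  exact (SimpleGraph.ConnectedComponent.mem_supp_congr_adj _ hab).1 ha

end MatchingMap

/-! ### Maximum matchings of forests -/

section Forest

open Function Set

variable {V : Type u} {G : SimpleGraph V} {m n : V → V} {a u v : V}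

lemma IsMatchingMap.mapsTo_farSide (hG : G.IsAcyclic) (hm : IsMatchingMap G m) (h : G.Adj u v)
    (hne : m v ≠ u) : MapsTo m (farSide G u v) (farSide G u v) := fun w hw => by
  by_contra hmw
  have hw' : m w ≠ w := fun h' => hmw (by rwa [h'])
  obtain ⟨rfl, hu⟩ := eq_of_adj_of_mem_farSide hG h (hm.adj w hw') hw hmw
  exact hne hu

variable [Finite V]

/-- Otherwise, splicing along the edge `uv` a maximum matching missing `u` with one missing `v`
gives a maximum matching that misses both. -/
lemma not_adj_of_mayBeMissed (hG : G.IsAcyclic) (hu : MayBeMissed G u) (hv : MayBeMissed G v) :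
    ¬ G.Adj u v := fun h => by
  classical
  obtain ⟨m, hm, hmu⟩ := mayBeMissed_iff.1 hu
  obtain ⟨n, hn, hnv⟩ := mayBeMissed_iff.1 hv
  have hmU := hm.mapsTo_farSide hG h fun hvu => h.ne' (hm.invol.injective (hvu.trans hmu.symm))
  have hnU := hn.mapsTo_farSide hG h (hnv.trans_ne h.ne')
  refine (hn.piecewise hm hnU hmU).not_adj_of_apply_eq ?_ ?_ h
  · rw [piecewise_eq_of_notMem _ _ _ (notMem_farSide hG h), hmu]
  · rw [piecewise_eq_of_mem _ _ _ (mem_farSide_self G u v), hnv]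

/-- Let `b = m a` and let `r` be `m` without the edge `ab`. The two splicings of `n` and `r` along
`ab` together miss two vertices more than `m` and `n`. The one missing `a` is not maximum, so by
parity it accounts for both, and the other one is a maximum matching missing `b`. -/
lemma IsMaxMatchingMap.mayBeMissed_apply (hG : G.IsAcyclic) (hm : IsMaxMatchingMap G m)
    (hn : IsMaxMatchingMap G n) (ha : ¬ MayBeMissed G a) (hna : n a ≠ m a) :
    MayBeMissed G (m a) := by
  classical
  have hma : m a ≠ a := fun h => ha (mayBeMissed_iff.2 ⟨m, hm, h⟩)
  have hadj := hm.adj a hma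
  set U := farSide G a (m a)
  set r := ({a, m a} : Set V).piecewise id m
  have hra : r a = a := piecewise_eq_of_mem _ _ _ (Or.inl rfl)
  have hrb : r (m a) = m a := piecewise_eq_of_mem _ _ _ (Or.inr rfl)
  have hr : IsMatchingMap G r := hm.erase a
  have hrU : MapsTo r U U := hr.mapsTo_farSide hG hadj (by rwa [hrb])
  have hnU : MapsTo n U U := hn.mapsTo_farSide hG hadj fun h => hna (hn.invol.eq_iff.1 h).symm
  have hp := hn.toIsMatchingMap.piecewise hr hnU hrU
  have hq := hr.piecewise hn.toIsMatchingMap hrU hnU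
  have hp_lt : (fixedPoints m).ncard < (fixedPoints (U.piecewise n r)).ncard := by
    by_contra! hle
    refine ha (mayBeMissed_iff.2 ⟨_, hm.of_ncard_le hp hle, ?_⟩)
    rw [piecewise_eq_of_notMem _ _ _ (notMem_farSide hG hadj), hra]
  refine mayBeMissed_iff.2 ⟨_, hm.of_ncard_le hq ?_, ?_⟩
  · have := ncard_fixedPoints_piecewise_add (U := U) n r
    have : (fixedPoints r).ncard = (fixedPoints m).ncard + 2 := hm.ncard_fixedPoints_erase hma
    have := hn.ncard_le m hm.toIsMatchingMap
    have := hm.two_mul_ncard_edgeSet_add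
    have := hp.two_mul_ncard_edgeSet_add
    omega
  · rw [piecewise_eq_of_mem _ _ _ (mem_farSide_self G a (m a)), hrb]

lemma IsMaxMatchingMap.mayBeMissed_apply_of_no_edge_in_all (hG : G.IsAcyclic)
    (hedge : ∀ e ∈ G.edgeSet, ∃ M : G.Subgraph, IsMaximumMatching M ∧ e ∉ M.edgeSet)
    (hm : IsMaxMatchingMap G m) (ha : ¬ MayBeMissed G a) : MayBeMissed G (m a) := by
  have hma : m a ≠ a := fun h => ha (mayBeMissed_iff.2 ⟨m, hm, h⟩)
  obtain ⟨N, hN, he⟩ := hedge s(a, m a) (hm.adj a hma)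
  obtain ⟨n, hn, rfl⟩ := hN.exists_toSubgraph_eq
  exact hm.mayBeMissed_apply hG hn ha fun h => he ⟨h, hma.symm⟩

/-- `m` matches the vertices that cannot be missed with the missable vertices it covers. -/
lemma IsMaxMatchingMap.ncard_fixedPoints_add (hG : G.IsAcyclic)
    (hedge : ∀ e ∈ G.edgeSet, ∃ M : G.Subgraph, IsMaximumMatching M ∧ e ∉ M.edgeSet)
    (hm : IsMaxMatchingMap G m) :
    (fixedPoints m).ncard + {v | ¬ MayBeMissed G v}.ncard = {v | MayBeMissed G v}.ncard := by
  have hfix : fixedPoints m ⊆ {v | MayBeMissed G v} := fun v hv => mayBeMissed_iff.2 ⟨m, hm, hv⟩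
  have himage : m '' {v | ¬ MayBeMissed G v} = {v | MayBeMissed G v} \ fixedPoints m := by
    ext v
    constructor
    · rintro ⟨a, ha, rfl⟩
      exact ⟨hm.mayBeMissed_apply_of_no_edge_in_all hG hedge ha,
        fun h => ha (hfix (hm.invol.injective h))⟩
    · rintro ⟨hv, hmv⟩
      exact ⟨m v, fun h => not_adj_of_mayBeMissed hG hv h (hm.adj v hmv), hm.invol v⟩
  rw [← ncard_image_of_injective {v | ¬ MayBeMissed G v} hm.invol.injective, himage, add_comm,
    ncard_sdiff_add_ncard_of_subset hfix]

end Forest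

/-! ### Missable and core vertices of a meta skeleton -/

/-- `v` is neither in `X` nor missable. These vertices form the core of the meta skeleton: they are
covered by every maximum matching of `S \ X`, are not substituted in a blow-up, and turn out to be
the common boundary zero set of the blown-up graph. -/
def IsCore {V : Type u} (S : SimpleGraph V) (X : Set V) (v : V) : Prop :=
  v ∉ X ∧ ¬ IsMissable S X v

section MetaSkeleton

variable {V : Type u} [Finite V] {S : SimpleGraph V} {X : Set V} {u v : V} {m : ↥Xᶜ → ↥Xᶜ}

lemma isMissable_coe_iff {v : ↥Xᶜ} : IsMissable S X v ↔ MayBeMissed (S.induce Xᶜ) v :=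
  (exists_prop_of_true v.2).trans (mayBeMissedInComponent_iff v)

namespace IsMetaSkeleton

variable (hS : IsMetaSkeleton S X)
include hS

omit [Finite V] in
lemma isAcyclic_induce : (S.induce Xᶜ).IsAcyclic := hS.isTree.isAcyclic.induce _

omit [Finite V] in
lemma not_adj_of_isMissable_of_mem (hu : IsMissable S X u) (hv : v ∈ X) : ¬ S.Adj u v := fun h =>
  hS.adj_not_missed ⟨u, hu.1⟩ v hv h hu.2

lemma not_adj_of_isMissable (hu : IsMissable S X u) (hv : IsMissable S X v) : ¬ S.Adj u v := by
  lift u to ↥Xᶜ using hu.1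
  lift v to ↥Xᶜ using hv.1
  exact not_adj_of_mayBeMissed (G := S.induce Xᶜ) hS.isAcyclic_induce (isMissable_coe_iff.1 hu)
    (isMissable_coe_iff.1 hv)

lemma isCore_of_adj (hu : ¬ IsCore S X u) (h : S.Adj u v) : IsCore S X v := by
  by_cases huX : u ∈ X
  · exact ⟨fun hv => hS.isIndepSet huX hv h.ne h,
      fun hv => hS.not_adj_of_isMissable_of_mem hv huX h.symm⟩
  · have hu' : IsMissable S X u := by_contra fun hu' => hu ⟨huX, hu'⟩
    exact ⟨fun hv => hS.not_adj_of_isMissable_of_mem hu' hv h,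
      fun hv => hS.not_adj_of_isMissable hu' hv h⟩

lemma isMissable_apply (hm : IsMaxMatchingMap (S.induce Xᶜ) m) {a : ↥Xᶜ}
    (ha : ¬ IsMissable S X a) : IsMissable S X (m a) := by
  rw [isMissable_coe_iff] at ha ⊢
  exact hm.mayBeMissed_apply_of_no_edge_in_all hS.isAcyclic_induce hS.no_edge_in_all ha

lemma exists_isMissable (hX : X ≠ Set.univ) : ∃ v, IsMissable S X v := by
  obtain ⟨v, hv⟩ := (Set.ne_univ_iff_exists_notMem X).1 hX
  by_cases h : IsMissable S X v
  · exact ⟨v, h⟩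
  · obtain ⟨m, hm⟩ := exists_isMaxMatchingMap (S.induce Xᶜ)
    exact ⟨_, hS.isMissable_apply hm (a := ⟨v, hv⟩) h⟩

/-- The missable vertex with which a maximum matching of `S \ X` matches a core vertex. -/
def partner (hm : IsMaxMatchingMap (S.induce Xᶜ) m) (a : {v // IsCore S X v}) :
    {v // IsMissable S X v} :=
  ⟨m ⟨a, a.2.1⟩, hS.isMissable_apply hm a.2.2⟩

lemma partner_injective (hm : IsMaxMatchingMap (S.induce Xᶜ) m) :
    Function.Injective (hS.partner hm) := fun a b hab => by
  have h : m ⟨a, a.2.1⟩ = m ⟨b, b.2.1⟩ :=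
    Subtype.ext (show (hS.partner hm a : V) = hS.partner hm b by rw [hab])
  exact Subtype.ext (Subtype.mk.inj (hm.invol.injective h))

lemma adj_partner (hm : IsMaxMatchingMap (S.induce Xᶜ) m) (a : {v // IsCore S X v}) :
    S.Adj (hS.partner hm a) a := by
  refine (hm.adj ⟨a, a.2.1⟩ fun h => a.2.2 ?_).symm
  simpa only [h] using hS.isMissable_apply hm (a := ⟨a, a.2.1⟩) a.2.2

lemma partner_ne (hm : IsMaxMatchingMap (S.induce Xᶜ) m) {d : {v // IsMissable S X v}}
    (hd : m ⟨d, d.2.1⟩ = ⟨d, d.2.1⟩) (a : {v // IsCore S X v}) :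
    hS.partner hm a ≠ d := fun had => by
  have h : m ⟨a, a.2.1⟩ = ⟨d, d.2.1⟩ := Subtype.ext (show (hS.partner hm a : V) = d by rw [had])
  have had' : (a : V) = d := Subtype.mk.inj (hm.invol.injective (h.trans hd.symm))
  exact a.2.2 (had' ▸ d.2)

lemma ncard_compl_verts_add {M : (S.induce Xᶜ).Subgraph} (hM : IsMaximumMatching M) :
    M.vertsᶜ.ncard + {v | IsCore S X v}.ncard = {v | IsMissable S X v}.ncard := by
  obtain ⟨m, hm, rfl⟩ := hM.exists_toSubgraph_eq
  have hcore : {v | IsCore S X v} = Subtype.val '' {v | ¬ MayBeMissed (S.induce Xᶜ) v} := by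
    ext v
    refine ⟨fun hv => ⟨⟨v, hv.1⟩, isMissable_coe_iff.not.1 hv.2, rfl⟩, ?_⟩
    rintro ⟨v, hv, rfl⟩
    exact ⟨v.2, isMissable_coe_iff.not.2 hv⟩
  have hmiss : {v | IsMissable S X v} = Subtype.val '' {v | MayBeMissed (S.induce Xᶜ) v} := by
    ext v
    refine ⟨fun hv => ⟨⟨v, hv.1⟩, isMissable_coe_iff.1 hv, rfl⟩, ?_⟩
    rintro ⟨v, hv, rfl⟩
    exact isMissable_coe_iff.2 hv
  rw [hcore, hmiss, Set.ncard_image_of_injective _ Subtype.val_injective,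
    Set.ncard_image_of_injective _ Subtype.val_injective,
    ← hm.ncard_fixedPoints_add hS.isAcyclic_induce hS.no_edge_in_all]
  simp only [IsMatchingMap.toSubgraph, compl_compl]

end IsMetaSkeleton

end MetaSkeleton

/-! ### Circulations and determinants on forests -/

section Circulation

variable {V : Type u} {G : SimpleGraph V}

lemma sum_sum_eq_zero_of_antisymm {A : Type*} [AddCommGroup A] {f : V → V → A}
    (hanti : ∀ a b, f a b = -f b a) (hdiag : ∀ a, f a a = 0) (U : Finset V) :
    ∑ a ∈ U, ∑ b ∈ U, f a b = 0 := by
  rw [← Finset.sum_product']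
  refine Finset.sum_involution (fun p _ => p.swap) (fun p _ => ?_) (fun p _ hp hswap => hp ?_)
    (fun p hp => Finset.mem_product.2 (Finset.mem_product.1 hp).symm)
    fun p _ => p.swap_swap
  · rw [hanti p.1 p.2, Prod.fst_swap, Prod.snd_swap, neg_add_cancel]
  · rw [← congrArg Prod.fst hswap, Prod.fst_swap, hdiag]

lemma circulation_eq_zero [Fintype V] {A : Type*} [AddCommGroup A] (hG : G.IsAcyclic)
    {f : V → V → A} (hanti : ∀ a b, f a b = -f b a) (hsupp : ∀ a b, ¬ G.Adj a b → f a b = 0)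
    (hdiv : ∀ a, ∑ b, f a b = 0) (u v : V) : f u v = 0 := by
  classical
  by_cases h : G.Adj u v
  swap
  · exact hsupp _ _ h
  set U := (farSide G u v).toFinset
  have hinside : ∑ a ∈ U, ∑ b ∈ U, f a b = 0 :=
    sum_sum_eq_zero_of_antisymm hanti (fun a => hsupp a a (G.loopless.irrefl a)) U
  have houtflow : ∑ a ∈ U, ∑ b ∈ Uᶜ, f a b = f v u := by
    have hzero : ∀ a ∈ U, ∀ b ∈ Uᶜ, ¬ (a = v ∧ b = u) → f a b = 0 := fun a ha b hb hab =>
      hsupp a b fun hadj => hab <| eq_of_adj_of_mem_farSide hG h hadj (Set.mem_toFinset.1 ha)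
        fun hb' => Finset.mem_compl.1 hb (Set.mem_toFinset.2 hb')
    have hvU : v ∈ U := Set.mem_toFinset.2 (mem_farSide_self G u v)
    have huU : u ∈ Uᶜ := Finset.mem_compl.2 fun hu => notMem_farSide hG h (Set.mem_toFinset.1 hu)
    rw [Finset.sum_eq_single_of_mem v hvU, Finset.sum_eq_single_of_mem u huU]
    · exact fun b hb hbu => hzero v hvU b hb fun hab => hbu hab.2
    · exact fun a ha hav => Finset.sum_eq_zero fun b hb => hzero a ha b hb fun hab => hav hab.1
  calc f u v = -∑ a ∈ U, (∑ b ∈ U, f a b + ∑ b ∈ Uᶜ, f a b) := by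
        rw [Finset.sum_add_distrib, hinside, houtflow, zero_add, hanti]
    _ = 0 := by simp only [Finset.sum_add_sum_compl, hdiv, Finset.sum_const_zero, neg_zero]

lemma apply_comm_of_sum_eq_zero [Fintype V] {A : Type*} [AddCommGroup A] (hG : G.IsAcyclic)
    {f : V → V → A} (hsupp : ∀ a b, ¬ G.Adj a b → f a b = 0) (hrow : ∀ a, ∑ b, f a b = 0)
    (hcol : ∀ b, ∑ a, f a b = 0) (u v : V) : f u v = f v u :=
  sub_eq_zero.1 <| circulation_eq_zero hG (f := fun a b => f a b - f b a)
    (fun _ _ => (neg_sub _ _).symm)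
    (fun a b hab => by rw [hsupp a b hab, hsupp b a fun h => hab h.symm, sub_zero])
    (fun a => by rw [Finset.sum_sub_distrib, hrow, hcol, sub_zero]) u v

variable [Finite V] {α : Type*} {ι κ : α → V}

/-- The pairings `κ (σ a) — ι a` and `κ a — ι a` cover the same vertices, so that their difference,
as a matrix with row index `κ` and column index `ι`, has zero row and column sums. -/
lemma perm_eq_one_of_adj (hG : G.IsAcyclic) (hι : Function.Injective ι)
    (hκ : Function.Injective κ) (hικ : ∀ a b, ι a ≠ κ b) (hadj : ∀ a, G.Adj (κ a) (ι a))
    {σ : Equiv.Perm α} (hσ : ∀ a, G.Adj (κ (σ a)) (ι a)) : σ = 1 := by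
  classical
  have := Fintype.ofFinite V
  have := Finite.of_injective ι hι
  have := Fintype.ofFinite α
  let θ (x y : V) : ℤ :=
    ∑ a, ((if κ (σ a) = x ∧ ι a = y then 1 else 0) - if κ a = x ∧ ι a = y then 1 else 0)
  have hsupp : ∀ x y, ¬ G.Adj x y → θ x y = 0 := fun x y hxy => by
    refine Finset.sum_eq_zero fun a _ => ?_
    rw [if_neg, if_neg, sub_zero]
    · rintro ⟨rfl, rfl⟩
      exact hxy (hadj a)
    · rintro ⟨rfl, rfl⟩
      exact hxy (hσ a)
  have hrow : ∀ x, ∑ y, θ x y = 0 := fun x => by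
    rw [Finset.sum_comm]
    simp only [Finset.sum_sub_distrib, ite_and, Finset.sum_ite_irrel, Finset.sum_ite_eq,
      Finset.mem_univ, if_true, Finset.sum_const_zero]
    rw [Equiv.sum_comp σ (fun a => if κ a = x then (1 : ℤ) else 0), sub_self]
  have hcol : ∀ y, ∑ x, θ x y = 0 := fun y => by
    rw [Finset.sum_comm]
    simp only [Finset.sum_sub_distrib, ite_and, Finset.sum_ite_eq, Finset.mem_univ, if_true,
      sub_self, Finset.sum_const_zero]
  ext a
  by_contra hne
  have hback : θ (ι a) (κ (σ a)) = 0 := Finset.sum_eq_zero fun b _ => by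
    simp only [hικ b (σ a), and_false, if_false, sub_zero]
  have hforth : θ (κ (σ a)) (ι a) = 1 := by
    refine (Finset.sum_eq_single_of_mem a (Finset.mem_univ a) fun b _ hb => ?_).trans ?_
    · simp only [hι.ne hb, and_false, if_false, sub_zero]
    · rw [if_pos ⟨rfl, rfl⟩, if_neg fun h => hne (hκ h.1).symm, sub_zero]
  exact one_ne_zero <|
    hforth.symm.trans <| (apply_comm_of_sum_eq_zero hG hsupp hrow hcol _ _).trans hback

lemma det_ne_zero_of_isAcyclic [Fintype α] [DecidableEq α] {R : Type*} [CommRing R] [IsDomain R]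
    (hG : G.IsAcyclic) (hι : Function.Injective ι) (hκ : Function.Injective κ)
    (hικ : ∀ a b, ι a ≠ κ b) {M : Matrix α α R} (hM : ∀ a b, M a b ≠ 0 → G.Adj (κ a) (ι b))
    (hdiag : ∀ a, M a a ≠ 0) : M.det ≠ 0 := by
  have hdet : M.det = ∏ a, M a a := by
    rw [Matrix.det_apply, Finset.sum_eq_single_of_mem 1 (Finset.mem_univ _)]
    · simp
    · intro σ _ hσ
      by_contra hne
      have hprod : ∏ a, M (σ a) a ≠ 0 := right_ne_zero_of_smul hne
      exact hσ <| perm_eq_one_of_adj hG hι hκ hικ (fun a => hM a a (hdiag a)) fun a =>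
        hM _ _ (Finset.prod_ne_zero_iff.1 hprod a (Finset.mem_univ a))
  rw [hdet]
  exact Finset.prod_ne_zero_iff.2 fun a _ => hdiag a

end Circulation

lemma exists_vecMul_eq_of_det_submatrix_ne_zero {α δ K : Type*} [Fintype α] [DecidableEq α]
    [Fintype δ] [Field K] {W : Matrix δ α K} {f : α → δ} (hf : Function.Injective f)
    (hdet : (W.submatrix f id).det ≠ 0) (z : α → K) :
    ∃ c : δ → K, Matrix.vecMul c W = z ∧ ∀ d ∉ Set.range f, c d = 0 := by
  obtain ⟨c, rfl⟩ := Matrix.vecMul_surjective_iff_isUnit.2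
    ((Matrix.isUnit_iff_isUnit_det _).2 hdet.isUnit) z
  refine ⟨Function.extend f c 0, ?_, fun d hd => Function.extend_apply' _ _ _ hd⟩
  ext b
  refine (Fintype.sum_of_injective f hf _ _ (fun d hd => ?_) fun a => ?_).symm
  · rw [Function.extend_apply' _ _ _ hd, Pi.zero_apply, zero_mul]
  · rw [hf.extend_apply]
    rfl

/-! ### Eigenvectors of trees -/

section Eigenvector

variable {V : Type u} [Fintype V] {G : SimpleGraph V} {lam : ℝ} {x y : V → ℝ}

open Classical in
lemma adjEnd_apply (G : SimpleGraph V) (x : V → ℝ) (v : V) :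
    adjEnd G x v = ∑ w, if G.Adj v w then x w else 0 := by
  simp [adjEnd, Matrix.mulVec, dotProduct, SimpleGraph.adjMatrix_apply]

lemma mem_eigenspace_iff :
    x ∈ Module.End.eigenspace (adjEnd G) lam ↔ ∀ v, adjEnd G x v = lam * x v := by
  rw [Module.End.mem_eigenspace_iff, funext_iff]
  rfl

lemma sum_mul_adjEnd_comm (G : SimpleGraph V) (x y : V → ℝ) :
    ∑ v, y v * adjEnd G x v = ∑ v, x v * adjEnd G y v := by
  classical
  simp only [adjEnd_apply, Finset.mul_sum]
  rw [Finset.sum_comm]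
  refine Finset.sum_congr rfl fun a _ => Finset.sum_congr rfl fun b _ => ?_
  simp only [G.adj_comm a b]
  split_ifs <;> ring

/-- On a forest, the circulation `y a * x b - y b * x a` on the edges `ab` vanishes. -/
lemma mul_eq_mul_of_adj (hG : G.IsAcyclic) (hx : x ∈ Module.End.eigenspace (adjEnd G) lam)
    (hy : y ∈ Module.End.eigenspace (adjEnd G) lam) {a b : V} (hab : G.Adj a b) :
    y a * x b = y b * x a := by
  classical
  have hcirc := circulation_eq_zero hG
    (f := fun a b => if G.Adj a b then y a * x b - y b * x a else 0)
    (fun a b => by simp only [G.adj_comm a b]; split_ifs <;> ring) (fun a b h => if_neg h)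
    (fun a => by
      calc ∑ b, (if G.Adj a b then y a * x b - y b * x a else 0)
          = ∑ b, (y a * (if G.Adj a b then x b else 0) - (if G.Adj a b then y b else 0) * x a) :=
            Finset.sum_congr rfl fun b _ => by split_ifs <;> ring
        _ = y a * adjEnd G x a - adjEnd G y a * x a := by
            rw [Finset.sum_sub_distrib, ← Finset.mul_sum, ← Finset.sum_mul, adjEnd_apply,
              adjEnd_apply]
        _ = 0 := by
            rw [mem_eigenspace_iff.1 hx, mem_eigenspace_iff.1 hy]
            ring)
  exact sub_eq_zero.1 ((if_pos hab).symm.trans (hcirc a b))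

lemma exists_eq_smul_of_forall_ne_zero (hG : G.IsTree)
    (hx : x ∈ Module.End.eigenspace (adjEnd G) lam)
    (hy : y ∈ Module.End.eigenspace (adjEnd G) lam) (hy0 : ∀ v, y v ≠ 0) : ∃ c : ℝ, x = c • y := by
  obtain ⟨r⟩ := hG.connected.nonempty
  refine ⟨x r / y r, funext fun v => (div_eq_iff (hy0 v)).1 ?_⟩
  obtain ⟨p⟩ := hG.connected.preconnected v r
  induction p with
  | nil => rfl
  | cons hab p ih =>
    rw [← ih, div_eq_div_iff (hy0 _) (hy0 _), mul_comm, mul_comm (x _)]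
    exact (mul_eq_mul_of_adj hG.isAcyclic hx hy hab).symm

end Eigenvector

namespace BlowUp

/-! ### The blown-up graph is a tree -/

section Graph

variable {V : Type u} {S : SimpleGraph V} {X : Set V} {lam : ℝ} (B : BlowUp.{u, w} S X lam)

lemma adj_same_iff {v : V} {a b : B.Part v} :
    B.graph.Adj ⟨v, a⟩ ⟨v, b⟩ ↔ (B.part v).Adj a b := by
  refine ⟨fun h => ?_, Adj.inner⟩
  cases h with
  | inner h => exact h
  | link h => exact (S.loopless.irrefl _ h).elim

lemma adj_iff_of_ne {u v : V} (huv : u ≠ v) {a : B.Part u} {b : B.Part v} :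
    B.graph.Adj ⟨u, a⟩ ⟨v, b⟩ ↔ S.Adj u v ∧ B.attach u v = a ∧ B.attach v u = b := by
  constructor
  · intro h
    cases h with
    | inner h => exact (huv rfl).elim
    | link h => exact ⟨h, rfl, rfl⟩
  · rintro ⟨h, rfl, rfl⟩
    exact Adj.link h

lemma fst_adj_of_adj {p q : B.Vert} (h : B.graph.Adj p q) (hne : p.1 ≠ q.1) : S.Adj p.1 q.1 :=
  ((B.adj_iff_of_ne hne).1 h).1

instance instNonemptyPart (v : V) : Nonempty (B.Part v) := (B.part_isTree v).connected.nonempty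

lemma subsingleton_part {v : V} (hv : IsCore S X v) : Subsingleton (B.Part v) :=
  B.part_of_other v hv.1 hv.2

lemma reachable_part {v : V} (a b : B.Part v) : B.graph.Reachable ⟨v, a⟩ ⟨v, b⟩ :=
  ((B.part_isTree v).connected.preconnected a b).map
    (⟨Sigma.mk v, Adj.inner⟩ : B.part v →g B.graph)

lemma graph_connected (hS : S.Connected) : B.graph.Connected := by
  have hreach : ∀ u v : V, ∀ a b, B.graph.Reachable ⟨u, a⟩ ⟨v, b⟩ := fun u v => by
    obtain ⟨p⟩ := hS.preconnected u v
    induction p with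
    | nil => exact B.reachable_part
    | cons huv _ ih =>
      exact fun a b => (B.reachable_part a _).trans <|
        (SimpleGraph.Adj.reachable (Adj.link huv)).trans (ih _ b)
  obtain ⟨r⟩ := hS.nonempty
  have : Nonempty B.Vert := ⟨⟨r, Classical.arbitrary _⟩⟩
  exact ⟨fun p q => hreach p.1 q.1 p.2 q.2⟩

/-- The edge of the blown-up graph that joins the chosen end vertices for an edge of `S`. -/
def linkEdge : Sym2 V → Sym2 B.Vert :=
  Sym2.lift ⟨fun u v => s(⟨u, B.attach u v⟩, ⟨v, B.attach v u⟩), fun _ _ => Sym2.eq_swap⟩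

lemma edgeSet_graph_subset : B.graph.edgeSet ⊆
    (⋃ v, Sym2.map (Sigma.mk v) '' (B.part v).edgeSet) ∪ B.linkEdge '' S.edgeSet := by
  intro e
  induction e using Sym2.ind with
  | h p q =>
    intro h
    cases h with
    | inner h => exact Or.inl (Set.mem_iUnion.2 ⟨_, s(_, _), h, rfl⟩)
    | link h => exact Or.inr ⟨s(_, _), h, rfl⟩

lemma graph_isTree [Finite V] (hS : S.IsTree) : B.graph.IsTree := by
  have := Fintype.ofFinite V
  have hconn := B.graph_connected hS.connected
  have hcardS := (SimpleGraph.isTree_iff_connected_and_card.1 hS).2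
  have hcardPart := fun v => (SimpleGraph.isTree_iff_connected_and_card.1 (B.part_isTree v)).2
  refine SimpleGraph.isTree_iff_connected_and_card.2
    ⟨hconn, le_antisymm ?_ hconn.card_vert_le_card_edgeSet_add_one⟩
  calc Nat.card B.graph.edgeSet + 1
      ≤ (⋃ v, Sym2.map (Sigma.mk v) '' (B.part v).edgeSet).ncard +
          (B.linkEdge '' S.edgeSet).ncard + 1 := by
        gcongr
        exact (Set.ncard_le_ncard B.edgeSet_graph_subset).trans (Set.ncard_union_le _ _)
    _ ≤ ∑ v, Nat.card (B.part v).edgeSet + Nat.card S.edgeSet + 1 := by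
        gcongr
        · exact (Set.ncard_iUnion_le_of_fintype _).trans
            (Finset.sum_le_sum fun v _ => Set.ncard_image_le)
        · exact Set.ncard_image_le
    _ = ∑ v, (Nat.card (B.part v).edgeSet + 1) := by
        rw [add_assoc, hcardS, Finset.sum_add_distrib, Nat.card_eq_fintype_card, Finset.sum_const,
          Finset.card_univ, smul_eq_mul, mul_one]
    _ = Nat.card B.Vert := by simp only [hcardPart, Nat.card_sigma]

end Graph

/-! ### The eigenspace of the blown-up graph -/

section Eigenspace

variable {V : Type u} {S : SimpleGraph V} {X : Set V} {lam : ℝ} (B : BlowUp.{u, w} S X lam)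

/-- A chosen nowhere vanishing eigenvector of the tree substituted for a missable vertex. -/
noncomputable def vec (d : {v // IsMissable S X v}) : B.Part d → ℝ :=
  (B.part_of_missable d d.2).choose

lemma vec_ne_zero (d : {v // IsMissable S X v}) (a : B.Part d) : B.vec d a ≠ 0 :=
  (B.part_of_missable d d.2).choose_spec.2 a

lemma vec_mem_eigenspace (d : {v // IsMissable S X v}) :
    B.vec d ∈ Module.End.eigenspace (adjEnd (B.part d)) lam :=
  (B.part_of_missable d d.2).choose_spec.1.1

open Classical in
/-- The vector with coefficients `c` on the chosen eigenvectors, zero elsewhere. -/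
noncomputable def spread : ({v // IsMissable S X v} → ℝ) →ₗ[ℝ] (B.Vert → ℝ) :=
  LinearMap.pi fun p =>
    if h : IsMissable S X p.1 then B.vec ⟨p.1, h⟩ p.2 • LinearMap.proj ⟨p.1, h⟩ else 0

lemma spread_coe (c : {v // IsMissable S X v} → ℝ) (d : {v // IsMissable S X v})
    (a : B.Part d) : B.spread c ⟨d, a⟩ = c d * B.vec d a := by
  rw [spread, LinearMap.pi_apply, dif_pos d.2]
  exact mul_comm _ _

lemma spread_of_not (c : {v // IsMissable S X v} → ℝ) {p : B.Vert} (h : ¬ IsMissable S X p.1) :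
    B.spread c p = 0 := by
  rw [spread, LinearMap.pi_apply, dif_neg h, LinearMap.zero_apply]

lemma spread_injective : Function.Injective B.spread := fun b c hbc => by
  ext d
  have h := congrFun hbc ⟨d, Classical.arbitrary _⟩
  rw [spread_coe, spread_coe] at h
  exact mul_right_cancel₀ (B.vec_ne_zero d _) h

open Classical in
/-- The values of the chosen eigenvectors at the ends of the edges between missable and core
vertices. -/
noncomputable def linkMatrix : Matrix {v // IsMissable S X v} {v // IsCore S X v} ℝ :=
  fun d a => if S.Adj d a then B.vec d (B.attach d a) else 0

variable [Fintype V]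

open Classical in
lemma adjEnd_graph (x : B.Vert → ℝ) (v : V) (a : B.Part v) :
    adjEnd B.graph x ⟨v, a⟩ = adjEnd (B.part v) (fun b => x ⟨v, b⟩) a +
      ∑ u, if S.Adj v u ∧ B.attach v u = a then x ⟨u, B.attach u v⟩ else 0 := by
  have hterm (u : V) : (∑ b, if B.graph.Adj ⟨v, a⟩ ⟨u, b⟩ then x ⟨u, b⟩ else 0) =
      (if u = v then adjEnd (B.part v) (fun b => x ⟨v, b⟩) a else 0) +
        if S.Adj v u ∧ B.attach v u = a then x ⟨u, B.attach u v⟩ else 0 := by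
    obtain rfl | huv := eq_or_ne u v
    · rw [if_pos rfl, if_neg fun h => S.loopless.irrefl _ h.1, add_zero, adjEnd_apply]
      simp only [B.adj_same_iff]
    · simp only [B.adj_iff_of_ne huv.symm, ← and_assoc, if_neg huv, zero_add]
      simp only [ite_and, Finset.sum_ite_irrel, Finset.sum_ite_eq, Finset.mem_univ, if_true,
        Finset.sum_const_zero]
  rw [adjEnd_apply, Fintype.sum_sigma, Finset.sum_congr rfl fun u _ => hterm u,
    Finset.sum_add_distrib, Finset.sum_ite_eq', if_pos (Finset.mem_univ v)]

open Classical in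
lemma sum_mul_adjEnd_graph (x : B.Vert → ℝ) {v : V} (y : B.Part v → ℝ) :
    ∑ a, y a * adjEnd B.graph x ⟨v, a⟩ = ∑ a, x ⟨v, a⟩ * adjEnd (B.part v) y a +
      ∑ u, if S.Adj v u then y (B.attach v u) * x ⟨u, B.attach u v⟩ else 0 := by
  simp only [adjEnd_graph, mul_add, Finset.sum_add_distrib]
  rw [sum_mul_adjEnd_comm]
  congr 1
  simp only [Finset.mul_sum, mul_ite, mul_zero]
  rw [Finset.sum_comm]
  simp only [ite_and, Finset.sum_ite_irrel, Finset.sum_ite_eq, Finset.mem_univ, if_true,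
    Finset.sum_const_zero]

variable {B} {x : B.Vert → ℝ}

open Classical in
lemma linkMatrix_mulVec_eq_zero (hS : IsMetaSkeleton S X)
    (hx : x ∈ Module.End.eigenspace (adjEnd B.graph) lam) :
    B.linkMatrix.mulVec (fun a => x ⟨a, Classical.arbitrary _⟩) = 0 := by
  ext d
  have hlink :
      ∑ u, (if S.Adj d u then B.vec d (B.attach d u) * x ⟨u, B.attach u d⟩ else 0) = 0 := by
    refine left_eq_add.1 (Eq.trans ?_ (B.sum_mul_adjEnd_graph x (B.vec d)))
    refine Finset.sum_congr rfl fun a _ => ?_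
    rw [mem_eigenspace_iff.1 (B.vec_mem_eigenspace d), mem_eigenspace_iff.1 hx]
    ring
  rw [Pi.zero_apply, ← hlink]
  refine Fintype.sum_of_injective Subtype.val Subtype.val_injective _ _ (fun u hu => ?_) fun a => ?_
  · exact if_neg fun h => hu ⟨⟨u, hS.isCore_of_adj (fun hd => hd.2 d.2) h⟩, rfl⟩
  · have := B.subsingleton_part a.2
    simp only [linkMatrix, ite_mul, zero_mul,
      Subsingleton.elim (B.attach a d) (Classical.arbitrary _)]

variable (B) in
open Classical in
lemma det_linkMatrix_submatrix_ne_zero (hS : IsMetaSkeleton S X) {m : ↥Xᶜ → ↥Xᶜ}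
    (hm : IsMaxMatchingMap (S.induce Xᶜ) m) :
    (B.linkMatrix.submatrix (hS.partner hm) id).det ≠ 0 := by
  refine det_ne_zero_of_isAcyclic hS.isTree.isAcyclic Subtype.val_injective
    (Subtype.val_injective.comp (hS.partner_injective hm))
    (fun a b hab => a.2.2 (hab ▸ (hS.partner hm b).2)) (fun a b hab => ?_) fun a => ?_
  · exact by_contra fun h => hab (if_neg h)
  · rw [Matrix.submatrix_apply, linkMatrix, id, if_pos (hS.adj_partner hm a)]
    exact B.vec_ne_zero _ _

lemma eq_zero_of_isCore (hS : IsMetaSkeleton S X)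
    (hx : x ∈ Module.End.eigenspace (adjEnd B.graph) lam) {p : B.Vert} (hp : IsCore S X p.1) :
    x p = 0 := by
  classical
  obtain ⟨v, a⟩ := p
  obtain ⟨m, hm⟩ := exists_isMaxMatchingMap (S.induce Xᶜ)
  have hzero := Matrix.eq_zero_of_mulVec_eq_zero (B.det_linkMatrix_submatrix_ne_zero hS hm) <|
    funext fun b => congrFun (linkMatrix_mulVec_eq_zero hS hx) (hS.partner hm b)
  have := B.subsingleton_part hp
  rw [Subsingleton.elim a (Classical.arbitrary _)]
  exact congrFun hzero ⟨v, hp⟩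

lemma adjEnd_graph_of_not_isCore (hS : IsMetaSkeleton S X)
    (hcore : ∀ p : B.Vert, IsCore S X p.1 → x p = 0) {v : V} (hv : ¬ IsCore S X v)
    (a : B.Part v) :
    adjEnd B.graph x ⟨v, a⟩ = adjEnd (B.part v) (fun b => x ⟨v, b⟩) a := by
  classical
  rw [adjEnd_graph, Finset.sum_eq_zero, add_zero]
  intro u _
  split_ifs with h
  · exact hcore _ (hS.isCore_of_adj hv h.1)
  · rfl

lemma restrict_mem_eigenspace (hS : IsMetaSkeleton S X)
    (hx : x ∈ Module.End.eigenspace (adjEnd B.graph) lam) {v : V} (hv : ¬ IsCore S X v) :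
    (fun a => x ⟨v, a⟩) ∈ Module.End.eigenspace (adjEnd (B.part v)) lam :=
  mem_eigenspace_iff.2 fun a => by
    rw [← adjEnd_graph_of_not_isCore hS (fun _ => eq_zero_of_isCore hS hx) hv,
      mem_eigenspace_iff.1 hx]

lemma eq_zero_of_not_isMissable (hS : IsMetaSkeleton S X)
    (hx : x ∈ Module.End.eigenspace (adjEnd B.graph) lam) {p : B.Vert}
    (hp : ¬ IsMissable S X p.1) : x p = 0 := by
  by_cases hpX : p.1 ∈ X
  · by_contra hne
    exact B.part_of_mem p.1 hpX <| Module.End.hasEigenvalue_of_hasEigenvector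
      ⟨restrict_mem_eigenspace hS hx fun h => h.1 hpX, fun h => hne (congrFun h p.2)⟩
  · exact eq_zero_of_isCore hS hx ⟨hpX, hp⟩

lemma exists_spread_eq (hS : IsMetaSkeleton S X)
    (hx : x ∈ Module.End.eigenspace (adjEnd B.graph) lam) : ∃ c, B.spread c = x := by
  choose c hc using fun d : {v // IsMissable S X v} => exists_eq_smul_of_forall_ne_zero
    (B.part_isTree d) (restrict_mem_eigenspace hS hx fun h => h.2 d.2) (B.vec_mem_eigenspace d)
    (B.vec_ne_zero d)
  refine ⟨c, funext fun p => ?_⟩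
  by_cases hp : IsMissable S X p.1
  · exact (B.spread_coe c ⟨p.1, hp⟩ p.2).trans (congrFun (hc ⟨p.1, hp⟩) p.2).symm
  · rw [B.spread_of_not c hp, eq_zero_of_not_isMissable hS hx hp]

variable (B)

open Classical in
lemma adjEnd_spread_of_isCore (c : {v // IsMissable S X v} → ℝ) {p : B.Vert}
    (hp : IsCore S X p.1) :
    adjEnd B.graph (B.spread c) p = Matrix.vecMul c B.linkMatrix ⟨p.1, hp⟩ := by
  obtain ⟨v, a⟩ := p
  have := B.subsingleton_part hp
  have hpart : (fun b => B.spread c ⟨v, b⟩) = 0 := funext fun b => B.spread_of_not c hp.2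
  rw [adjEnd_graph, hpart, map_zero, Pi.zero_apply, zero_add]
  refine (Fintype.sum_of_injective Subtype.val Subtype.val_injective _ _ (fun u hu => ?_)
    fun d => ?_).symm
  · rw [B.spread_of_not c fun h => hu ⟨⟨u, h⟩, rfl⟩, ite_self]
  · simp only [spread_coe, linkMatrix, S.adj_comm v d, Subsingleton.elim (B.attach v d) a,
      and_true, mul_ite, mul_zero]

lemma adjEnd_spread_of_not_isCore (hS : IsMetaSkeleton S X) (c : {v // IsMissable S X v} → ℝ)
    {p : B.Vert} (hp : ¬ IsCore S X p.1) :
    adjEnd B.graph (B.spread c) p = lam * B.spread c p := by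
  obtain ⟨v, a⟩ := p
  rw [adjEnd_graph_of_not_isCore hS (fun q hq => B.spread_of_not c hq.2) hp]
  by_cases hv : IsMissable S X v
  · lift v to {v // IsMissable S X v} using hv
    have hpart : (fun b => B.spread c ⟨v, b⟩) = c v • B.vec v := funext (B.spread_coe c v)
    rw [hpart, map_smul, Pi.smul_apply, mem_eigenspace_iff.1 (B.vec_mem_eigenspace v), spread_coe,
      smul_eq_mul, mul_left_comm]
  · have hpart : (fun b => B.spread c ⟨v, b⟩) = 0 := funext fun b => B.spread_of_not c hv
    rw [hpart, map_zero, B.spread_of_not c hv, mul_zero, Pi.zero_apply]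

open Classical in
lemma spread_mem_eigenspace_iff (hS : IsMetaSkeleton S X) (c : {v // IsMissable S X v} → ℝ) :
    B.spread c ∈ Module.End.eigenspace (adjEnd B.graph) lam ↔
      Matrix.vecMul c B.linkMatrix = 0 := by
  rw [mem_eigenspace_iff]
  constructor
  · intro h
    ext a
    rw [Pi.zero_apply, ← B.adjEnd_spread_of_isCore c (p := ⟨a, Classical.arbitrary _⟩) a.2, h,
      B.spread_of_not c a.2.2, mul_zero]
  · intro h p
    by_cases hp : IsCore S X p.1
    · rw [B.adjEnd_spread_of_isCore c hp, h, B.spread_of_not c hp.2, mul_zero, Pi.zero_apply]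
    · exact B.adjEnd_spread_of_not_isCore hS c hp

open Classical in
lemma eigenspace_eq_map_ker (hS : IsMetaSkeleton S X) :
    Module.End.eigenspace (adjEnd B.graph) lam =
      (LinearMap.ker B.linkMatrix.vecMulLinear).map B.spread := by
  ext x
  constructor
  · intro hx
    obtain ⟨c, rfl⟩ := exists_spread_eq hS hx
    exact ⟨c, (B.spread_mem_eigenspace_iff hS c).1 hx, rfl⟩
  · rintro ⟨c, hc, rfl⟩
    exact (B.spread_mem_eigenspace_iff hS c).2 hc

lemma multiplicity_add_ncard (hS : IsMetaSkeleton S X) :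
    multiplicity B.graph lam + {v | IsCore S X v}.ncard = {v | IsMissable S X v}.ncard := by
  classical
  have hsurj : LinearMap.range B.linkMatrix.vecMulLinear = ⊤ := by
    obtain ⟨m, hm⟩ := exists_isMaxMatchingMap (S.induce Xᶜ)
    refine LinearMap.range_eq_top.2 fun z => ?_
    obtain ⟨c, hc, -⟩ := exists_vecMul_eq_of_det_submatrix_ne_zero (hS.partner_injective hm)
      (B.det_linkMatrix_submatrix_ne_zero hS hm) z
    exact ⟨c, hc⟩
  have hrank := LinearMap.finrank_range_add_finrank_ker B.linkMatrix.vecMulLinear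
  rw [hsurj, finrank_top, Module.finrank_fintype_fun_eq_card, Module.finrank_fintype_fun_eq_card,
    ← Nat.card_eq_fintype_card, ← Nat.card_eq_fintype_card, add_comm] at hrank
  rw [multiplicity, eigenspace_eq_map_ker B hS,
    ← (Submodule.equivMapOfInjective _ B.spread_injective _).finrank_eq]
  exact hrank

open Classical in
/-- A maximum matching missing `d` gives an invertible submatrix of the link matrix that avoids the
row of `d`, so that this row is a combination of the other ones. -/
lemma exists_vecMul_linkMatrix_eq_zero (hS : IsMetaSkeleton S X) (d : {v // IsMissable S X v}) :
    ∃ c : {v // IsMissable S X v} → ℝ, Matrix.vecMul c B.linkMatrix = 0 ∧ c d ≠ 0 := by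
  obtain ⟨m, hm, hmd⟩ := mayBeMissed_iff.1 ((isMissable_coe_iff (v := (⟨d, d.2.1⟩ : ↥Xᶜ))).1 d.2)
  obtain ⟨c, hc, hcd⟩ := exists_vecMul_eq_of_det_submatrix_ne_zero (hS.partner_injective hm)
    (B.det_linkMatrix_submatrix_ne_zero hS hm) (Matrix.vecMul (Pi.single d 1) B.linkMatrix)
  refine ⟨c - Pi.single d 1, by rw [Matrix.sub_vecMul, hc, sub_self], ?_⟩
  rw [Pi.sub_apply, hcd d fun ⟨a, ha⟩ => hS.partner_ne hm hmd a ha, Pi.single_eq_same, zero_sub]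
  exact neg_ne_zero.2 one_ne_zero

lemma exists_isEigenvector_ne_zero (hS : IsMetaSkeleton S X) {p : B.Vert}
    (hp : IsMissable S X p.1) : ∃ x, IsEigenvector B.graph lam x ∧ x p ≠ 0 := by
  classical
  obtain ⟨c, hc, hcd⟩ := B.exists_vecMul_linkMatrix_eq_zero hS ⟨p.1, hp⟩
  have hne : B.spread c p ≠ 0 := by
    rw [B.spread_coe c ⟨p.1, hp⟩ p.2]
    exact mul_ne_zero hcd (B.vec_ne_zero ⟨p.1, hp⟩ p.2)
  exact ⟨B.spread c, ⟨(B.spread_mem_eigenspace_iff hS c).2 hc, fun h => hne (congrFun h p)⟩, hne⟩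

end Eigenspace

/-! ### Vanishing sets and contractions of the blown-up graph -/

section VanishingSets

variable {V : Type u} [Fintype V] {S : SimpleGraph V} {X : Set V} {lam : ℝ}
  (B : BlowUp.{u, w} S X lam)

lemma commonZeroSet_eq (hS : IsMetaSkeleton S X) :
    commonZeroSet B.graph lam = Sigma.fst ⁻¹' {v | IsMissable S X v}ᶜ := by
  ext p
  constructor
  · intro h hp
    obtain ⟨x, hx, hxp⟩ := B.exists_isEigenvector_ne_zero hS hp
    exact hxp (h x hx)
  · exact fun hp x hx => eq_zero_of_not_isMissable hS hx.1 hp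

variable {B} in
lemma isCore_of_mem_boundaryZeroSet (hS : IsMetaSkeleton S X) {x : B.Vert → ℝ}
    (hx : x ∈ Module.End.eigenspace (adjEnd B.graph) lam) {p : B.Vert}
    (hp : p ∈ boundaryZeroSet B.graph x) : IsCore S X p.1 := by
  obtain ⟨v, a⟩ := p
  obtain ⟨hzero, ⟨u, b⟩, hne, hadj⟩ := hp
  obtain ⟨c, rfl⟩ := exists_spread_eq hS hx
  have hu : IsMissable S X u := by
    by_contra hu
    exact hne (B.spread_of_not c hu)
  refine hS.isCore_of_adj (fun h => h.2 hu) (B.fst_adj_of_adj hadj.symm ?_)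
  rintro rfl
  lift u to {v // IsMissable S X v} using hu
  have hcu : c u = 0 := by
    have h : c u * B.vec u a = 0 := (B.spread_coe c u a).symm.trans hzero
    exact (mul_eq_zero.1 h).resolve_right (B.vec_ne_zero u a)
  exact hne ((B.spread_coe c u b).trans (mul_eq_zero_of_left hcu _))

lemma commonBoundaryZeroSet_eq (hS : IsMetaSkeleton S X) :
    commonBoundaryZeroSet B.graph lam = Sigma.fst ⁻¹' {v | IsCore S X v} := by
  ext ⟨v, a⟩
  refine ⟨fun ⟨x, hx, hp⟩ => isCore_of_mem_boundaryZeroSet hS hx.1 hp, fun hv => ?_⟩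
  obtain ⟨m, hm⟩ := exists_isMaxMatchingMap (S.induce Xᶜ)
  let d := hS.partner hm ⟨v, hv⟩
  obtain ⟨x, hx, hxd⟩ := B.exists_isEigenvector_ne_zero hS (p := ⟨d, B.attach d v⟩) d.2
  have := B.subsingleton_part hv
  refine ⟨x, hx, eq_zero_of_isCore hS hx.1 hv, _, hxd, ?_⟩
  rw [Subsingleton.elim a (B.attach v d)]
  exact Adj.link (hS.adj_partner hm ⟨v, hv⟩).symm

end VanishingSets

section Contraction

variable {V : Type u} {S : SimpleGraph V} {X : Set V} {lam : ℝ} {B : BlowUp.{u, w} S X lam}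
  {K L : Set V}

lemma fst_eq_of_reachable_induce (hK : S.IsIndepSet K) {Z : Set B.Vert}
    (hZ : Z = Sigma.fst ⁻¹' Kᶜ) {p q : ↥Zᶜ} (h : (B.graph.induce Zᶜ).Reachable p q) :
    p.1.1 = q.1.1 := by
  subst hZ
  obtain ⟨r⟩ := h
  induction r with
  | nil => rfl
  | @cons p q _ hpq _ ih =>
    rw [← ih]
    by_contra hne
    exact hK (not_not.1 p.2) (not_not.1 q.2) hne (B.fst_adj_of_adj hpq hne)

variable (B) in
lemma contractMk_eq_iff (hK : S.IsIndepSet K) {p q : B.Vert} :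
    contractMk B.graph (Sigma.fst ⁻¹' Kᶜ) p = contractMk B.graph (Sigma.fst ⁻¹' Kᶜ) q ↔
      p = q ∨ p.1 = q.1 ∧ p.1 ∈ K := by
  rw [contractMk, contractMk, Quotient.eq]
  refine or_congr_right ⟨?_, ?_⟩
  · exact fun ⟨hp, _, h⟩ => ⟨fst_eq_of_reachable_induce hK rfl h, not_not.1 hp⟩
  · obtain ⟨v, a⟩ := p
    obtain ⟨u, b⟩ := q
    rintro ⟨rfl, hv⟩
    have hmem (b : B.Part v) : (⟨v, b⟩ : B.Vert) ∈ (Sigma.fst ⁻¹' Kᶜ)ᶜ := not_not.2 hv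
    let toInduce : B.part v →g B.graph.induce (Sigma.fst ⁻¹' Kᶜ)ᶜ :=
      { toFun := fun b => ⟨⟨v, b⟩, hmem b⟩
        map_rel' := fun h => Adj.inner h }
    exact ⟨hmem a, hmem b, ((B.part_isTree v).connected.preconnected a b).map toInduce⟩

lemma fst_eq_of_contractMk_eq (hK : S.IsIndepSet K) {p q : B.Vert}
    (h : contractMk B.graph (Sigma.fst ⁻¹' Kᶜ) p = contractMk B.graph (Sigma.fst ⁻¹' Kᶜ) q) :
    p.1 = q.1 :=
  ((B.contractMk_eq_iff hK).1 h).elim (congrArg Sigma.fst) And.left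

lemma contractMk_eq_of_fst_eq (hK : S.IsIndepSet K)
    (hL : ∀ v ∈ L, v ∉ K → Subsingleton (B.Part v)) {p q : B.Vert} (hp : p.1 ∈ L)
    (h : p.1 = q.1) :
    contractMk B.graph (Sigma.fst ⁻¹' Kᶜ) p = contractMk B.graph (Sigma.fst ⁻¹' Kᶜ) q := by
  obtain ⟨v, a⟩ := p
  obtain ⟨u, b⟩ := q
  obtain rfl : v = u := h
  refine (B.contractMk_eq_iff hK).2 (or_iff_not_imp_right.2 fun hv => ?_)
  have := hL v hp fun hvK => hv ⟨rfl, hvK⟩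
  rw [Subsingleton.elim a b]

lemma contract_adj_iff (hK : S.IsIndepSet K) (hL : ∀ v ∈ L, v ∉ K → Subsingleton (B.Part v))
    {p q : B.Vert} (hp : p.1 ∈ L) (hq : q.1 ∈ L) :
    (contract B.graph (Sigma.fst ⁻¹' Kᶜ)).Adj (contractMk B.graph _ p) (contractMk B.graph _ q) ↔
      S.Adj p.1 q.1 := by
  rw [contract, SimpleGraph.map_adj']
  constructor
  · rintro ⟨hne, p', q', h, hp', hq'⟩
    rw [← fst_eq_of_contractMk_eq hK hp', ← fst_eq_of_contractMk_eq hK hq']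
    refine B.fst_adj_of_adj h fun h' => hne (contractMk_eq_of_fst_eq hK hL hp ?_)
    rw [← fst_eq_of_contractMk_eq hK hp', ← fst_eq_of_contractMk_eq hK hq', h']
  · exact fun h => ⟨fun h' => h.ne (fst_eq_of_contractMk_eq hK h'),
      ⟨p.1, B.attach p.1 q.1⟩, ⟨q.1, B.attach q.1 p.1⟩, Adj.link h,
      contractMk_eq_of_fst_eq (p := ⟨_, _⟩) hK hL hp rfl,
      contractMk_eq_of_fst_eq (p := ⟨_, _⟩) hK hL hq rfl⟩

variable (B) in
lemma exists_induce_contract_iso (hK : S.IsIndepSet K)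
    (hL : ∀ v ∈ L, v ∉ K → Subsingleton (B.Part v)) :
    ∃ ψ : (contract B.graph (Sigma.fst ⁻¹' Kᶜ)).induce
        (contractMk B.graph (Sigma.fst ⁻¹' Kᶜ) '' (Sigma.fst ⁻¹' L)) ≃g S.induce L,
      ∀ (p : B.Vert) (hp : contractMk B.graph (Sigma.fst ⁻¹' Kᶜ) p ∈
        contractMk B.graph (Sigma.fst ⁻¹' Kᶜ) '' (Sigma.fst ⁻¹' L)),
        (ψ ⟨_, hp⟩ : V) = p.1 := by
  let proj : ContractVert B.graph (Sigma.fst ⁻¹' Kᶜ) → V :=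
    Quotient.lift Sigma.fst fun p q h => fst_eq_of_contractMk_eq hK (Quotient.sound h)
  have hproj : Set.BijOn proj (contractMk B.graph _ '' (Sigma.fst ⁻¹' L)) L := by
    refine ⟨?_, ?_, fun v hv => ⟨_, ⟨⟨v, Classical.arbitrary _⟩, hv, rfl⟩, rfl⟩⟩
    · rintro _ ⟨p, hp, rfl⟩
      exact hp
    · rintro _ ⟨p, hp, rfl⟩ _ ⟨q, _, rfl⟩ h
      exact contractMk_eq_of_fst_eq hK hL hp h
  refine ⟨⟨hproj.equiv, ?_⟩, fun p hp => rfl⟩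
  rintro ⟨_, p, hp, rfl⟩ ⟨_, q, hq, rfl⟩
  exact (contract_adj_iff hK hL hp hq).symm

end Contraction

section Skeleton

variable {V : Type u} [Fintype V] {S : SimpleGraph V} {X : Set V} {lam : ℝ}
  (B : BlowUp.{u, w} S X lam)

lemma exists_skeleton_iso (hS : IsMetaSkeleton S X) :
    ∃ ψ : skeleton B.graph lam ≃g S.induce Xᶜ,
      ∀ (p : B.Vert) (hp : contractMk B.graph (commonZeroSet B.graph lam) p ∈
        skeletonVerts B.graph lam), (ψ ⟨_, hp⟩ : V) = p.1 := by
  have hverts : Sigma.fst ⁻¹' {v | IsCore S X v} ∪ (Sigma.fst ⁻¹' {v | IsMissable S X v}ᶜ)ᶜ =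
      (Sigma.fst ⁻¹' Xᶜ : Set B.Vert) := by
    ext p
    exact ⟨fun h => h.elim And.left fun h => (not_not.1 h).1,
      fun h => or_iff_not_imp_right.2 fun h' => ⟨h, not_not.1 h'⟩⟩
  unfold skeleton skeletonVerts
  rw [B.commonBoundaryZeroSet_eq hS, B.commonZeroSet_eq hS, hverts]
  exact B.exists_induce_contract_iso (fun u hu v hv _ => hS.not_adj_of_isMissable hu hv)
    fun v hv hv' => B.subsingleton_part ⟨hv, hv'⟩

lemma exists_metaSkeleton_iso (hS : IsMetaSkeleton S X) :
    ∃ φ : metaSkeleton B.graph lam ≃g S, ∀ p : B.Vert,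
      φ (contractMk B.graph (commonBoundaryZeroSet B.graph lam) p) = p.1 := by
  unfold metaSkeleton
  rw [B.commonBoundaryZeroSet_eq hS, ← compl_compl {v | IsCore S X v}]
  have h := B.exists_induce_contract_iso (K := {v | IsCore S X v}ᶜ) (L := Set.univ)
    (fun u hu v hv _ h => hv (hS.isCore_of_adj hu h))
    fun v _ hv => B.subsingleton_part (not_not.1 hv)
  have hsurj : Function.Surjective (contractMk B.graph (Sigma.fst ⁻¹' {v | IsCore S X v}ᶜᶜ)) :=
    Quotient.mk_surjective
  rw [Set.preimage_univ, Set.image_univ, hsurj.range_eq] at h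
  obtain ⟨ψ, hψ⟩ := h
  exact ⟨(SimpleGraph.induceUnivIso _).symm.trans (ψ.trans (SimpleGraph.induceUnivIso _)),
    fun p => hψ p trivial⟩

end Skeleton

end BlowUp

end TreeSkeleton

theorem mainTheorem8 {V : Type u} [Fintype V] (S : SimpleGraph V) (X : Set V) (lam : ℝ)
    (hS : TreeSkeleton.IsMetaSkeleton S X) (hX : X ≠ Set.univ)
    (B : TreeSkeleton.BlowUp.{u, w} S X lam) :
    B.graph.IsTree ∧
    TreeSkeleton.HasEigenvalue B.graph lam ∧
    (∀ M : (S.induce Xᶜ).Subgraph, TreeSkeleton.IsMaximumMatching M →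
      TreeSkeleton.multiplicity B.graph lam = M.vertsᶜ.ncard) ∧
    (∃ ψ : TreeSkeleton.skeleton B.graph lam ≃g S.induce Xᶜ,
      ∀ (p : B.Vert) (hp : TreeSkeleton.contractMk B.graph
          (TreeSkeleton.commonZeroSet B.graph lam) p ∈ TreeSkeleton.skeletonVerts B.graph lam),
        (ψ ⟨_, hp⟩ : V) = p.1) ∧
    (∃ φ : TreeSkeleton.metaSkeleton B.graph lam ≃g S,
      ∀ p : B.Vert, φ (TreeSkeleton.contractMk B.graph
        (TreeSkeleton.commonBoundaryZeroSet B.graph lam) p) = p.1) := by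
  obtain ⟨d, hd⟩ := hS.exists_isMissable hX
  refine ⟨B.graph_isTree hS.isTree, ?_, fun M hM => ?_, B.exists_skeleton_iso hS,
    B.exists_metaSkeleton_iso hS⟩
  · obtain ⟨x, hx, -⟩ := B.exists_isEigenvector_ne_zero hS (p := ⟨d, B.attach d d⟩) hd
    exact Module.End.hasEigenvalue_of_hasEigenvector hx
  · have hmult := B.multiplicity_add_ncard hS
    have hmissed := hS.ncard_compl_verts_add hM
    omega
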